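/- Let $q=2^r$ with $r\ge 1$, let $V$ be a two-dimensional vector space over the field $\mathbb F_{q^2}$ with a non-degenerate hermitian form $f$ (linear in the first variable, $f(v,u)=f(u,v)^q$), and let $G=V\times\mathbb F_{q^2}$ be the group of order $q^6$ with multiplication $(u,a)(v,b)=(u+v,\,f(u,v)+a+b)$. Let $u_1,u_2$ be an orthonormal basis of $V$, let $\mu$ be a generator of $\mathbb F_{q^2}^\times$, put $\lambda=\mu^{q-1}$, let $\sigma$ be the isometry of $V$ with $\sigma(\alpha u_1+\beta u_2)=\alpha\lambda u_1+\beta u_2$, and put $\hat\sigma(u,a)=(\sigma(u),a)$, an automorphism of $G$ of order $q+1$. Let $\chi$ be an irreducible complex character of $G$ of degree $q^2$. Then $\chi$ is the character of a representation $X$ of $G$ on $\mathbb R^{q^2}$. For every such $X$, there is a positive definite symmetric bilinear form $B$ on $\mathbb R^{q^2}$ preserved by $X$; for every such $B$, there is a linear automorphism $D$ of $\mathbb R^{q^2}$ that satisfies \[ X(\hat\sigma(x))=DX(x)D^{-1}\quad (x\in G),\qquad D^{q+1}=I, \] and preserves $B$. For every such $D$, the following hold. (1) The fixed point space of $\langle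 D\rangle$ on $\mathbb R^{q^2}$ is trivial. (2) Let $U$ be a one-dimensional totally isotropic subspace of $V$ and let $\hat U=\{(u,0):u\in U\}$. There is a $B$-orthonormal basis of $\mathbb R^{q^2}$ consisting of simultaneous eigenvectors of the elements of $X(\hat U)$. With respect to every such basis and for every $1\le i\le q$, all diagonal entries of the matrix of $D^i$ equal $-1/q$. Moreover, the matrix $qD^i$ is a real Hadamard matrix, and all its diagonal entries equal $-1$. -/

import Mathlib

/-- A form on `V`, linear in the first variable and semilinear in the second with respect to
`x ↦ x ^ (2 ^ r)`. -/
abbrev SesqForm (r : ℕ) (K V : Type*) [Field K] [CharP K 2] [AddCommGroup V] [Module K V] :=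
  V →ₗ[K] V →ₛₗ[iterateFrobenius K 2 r] K

/-- A non-degenerate hermitian form over the field with `q ^ 2` elements, `q = 2 ^ r`. -/
structure IsNondegHermitian {r : ℕ} {K V : Type*} [Field K] [CharP K 2] [AddCommGroup V]
    [Module K V] (f : SesqForm r K V) : Prop where
  conj_symm : ∀ u v : V, f v u = (f u v) ^ (2 ^ r)
  nondeg : ∀ u : V, (∀ w : V, f u w = 0) → u = 0

/-- The underlying set `V × K` of the group `G`. -/
@[ext]
structure HGroup {r : ℕ} {K V : Type*} [Field K] [CharP K 2] [AddCommGroup V] [Module K V]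
    (f : SesqForm r K V) where
  vec : V
  scal : K

namespace HGroup

variable {r : ℕ} {K V : Type*} [Field K] [CharP K 2] [AddCommGroup V] [Module K V]
  {f : SesqForm r K V}

instance : Mul (HGroup f) := ⟨fun x y => ⟨x.vec + y.vec, f x.vec y.vec + x.scal + y.scal⟩⟩

instance : One (HGroup f) := ⟨⟨0, 0⟩⟩

instance : Inv (HGroup f) := ⟨fun x => ⟨x.vec, f x.vec x.vec + x.scal⟩⟩

theorem mul_def (x y : HGroup f) :
    x * y = ⟨x.vec + y.vec, f x.vec y.vec + x.scal + y.scal⟩ := rfl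

theorem one_def : (1 : HGroup f) = ⟨0, 0⟩ := rfl

theorem inv_def (x : HGroup f) : x⁻¹ = ⟨x.vec, f x.vec x.vec + x.scal⟩ := rfl

theorem vec_add_self (K : Type*) {V : Type*} [Field K] [CharP K 2] [AddCommGroup V] [Module K V]
    (u : V) : u + u = 0 := by
  have h : ((1 : K) + 1) • u = u + u := by rw [add_smul, one_smul]
  rw [← h, CharTwo.add_self_eq_zero, zero_smul]

instance : Group (HGroup f) :=
  Group.ofLeftAxioms
    (fun x y z => by
      simp only [mul_def, map_add, LinearMap.add_apply, mk.injEq]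
      constructor <;> abel)
    (fun x => by simp [mul_def, one_def])
    (fun x => by
      simp only [mul_def, inv_def, one_def, mk.injEq]
      refine ⟨vec_add_self K _, ?_⟩
      rw [add_assoc (f x.vec x.vec), ← add_assoc, ← add_assoc, CharTwo.add_self_eq_zero, zero_add,
        CharTwo.add_self_eq_zero])

end HGroup

/-- The map `σ̂ (u, a) = (σ u, a)` of `G` attached to a linear map `σ` of `V`. -/
def hatMap {r : ℕ} {K V : Type*} [Field K] [CharP K 2] [AddCommGroup V] [Module K V]
    {f : SesqForm r K V} (σ : V →ₗ[K] V) (x : HGroup f) : HGroup f :=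
  ⟨σ x.vec, x.scal⟩

/-- The linear map with `σ (α u₁ + β u₂) = α lam u₁ + β u₂`, where `u₁ = e 0`, `u₂ = e 1`. -/
noncomputable def sigmaMap {K V : Type*} [Field K] [AddCommGroup V] [Module K V]
    (e : Module.Basis (Fin 2) K V) (lam : K) : V →ₗ[K] V :=
  e.constr K ![lam • e 0, e 1]

/-- The real representation `X` affords the character of the complex representation `Y`. -/
def Affords {G : Type*} [Group G] {n : ℕ} (X : Representation ℝ G (Fin n → ℝ))
    (Y : Representation ℂ G (Fin n → ℂ)) : Prop :=
  ∀ g : G, ((X.character g : ℝ) : ℂ) = Y.character g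

/-- `B` is a positive definite symmetric bilinear form preserved by `X`. -/
structure IsInvariantForm {G : Type*} [Group G] {n : ℕ} (X : Representation ℝ G (Fin n → ℝ))
    (B : LinearMap.BilinForm ℝ (Fin n → ℝ)) : Prop where
  symm : ∀ v w, B v w = B w v
  pos : ∀ v, v ≠ 0 → 0 < B v v
  invariant : ∀ (g : G) (v w), B (X g v) (X g w) = B v w

/-- `D` conjugates `X` into `X ∘ s`, preserves `B`, and satisfies `D ^ m = 1`. -/
structure IsNormalizer {G : Type*} [Group G] {n : ℕ} (X : Representation ℝ G (Fin n → ℝ))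
    (B : LinearMap.BilinForm ℝ (Fin n → ℝ)) (s : G → G) (m : ℕ)
    (D : (Fin n → ℝ) ≃ₗ[ℝ] (Fin n → ℝ)) : Prop where
  conj : ∀ (x : G) (v : Fin n → ℝ), X (s x) v = D (X x (D.symm v))
  pow_eq_one : D ^ m = 1
  isometry : ∀ v w, B (D v) (D w) = B v w

/-- `U` is a one-dimensional totally isotropic subspace of `V`. -/
structure IsIsotropicLine {r : ℕ} {K V : Type*} [Field K] [CharP K 2] [AddCommGroup V]
    [Module K V] (f : SesqForm r K V) (U : Submodule K V) : Prop where
  finrank_eq : Module.finrank K U = 1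
  isotropic : ∀ u ∈ U, ∀ v ∈ U, f u v = 0

/-- `Z` is a `B`-orthonormal basis of simultaneous eigenvectors of the `X (u, 0)`, `u ∈ U`. -/
structure IsEigenbasis {r : ℕ} {K V : Type*} [Field K] [CharP K 2] [AddCommGroup V]
    [Module K V] {f : SesqForm r K V} {n : ℕ}
    (X : Representation ℝ (HGroup f) (Fin n → ℝ)) (B : LinearMap.BilinForm ℝ (Fin n → ℝ))
    (U : Submodule K V) (Z : Module.Basis (Fin n) ℝ (Fin n → ℝ)) : Prop where
  orthonormal : ∀ i j, B (Z i) (Z j) = if i = j then 1 else 0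
  eigen : ∀ u ∈ U, ∀ i, ∃ c : ℝ, X (⟨u, 0⟩ : HGroup f) (Z i) = c • Z i

/-- The matrix of `D ^ i` in the basis `Z`. -/
noncomputable def powMatrix {n : ℕ} (Z : Module.Basis (Fin n) ℝ (Fin n → ℝ))
    (D : (Fin n → ℝ) ≃ₗ[ℝ] (Fin n → ℝ)) (i : ℕ) : Matrix (Fin n) (Fin n) ℝ :=
  LinearMap.toMatrix Z Z ((D ^ i : (Fin n → ℝ) ≃ₗ[ℝ] (Fin n → ℝ)) : (Fin n → ℝ) →ₗ[ℝ] (Fin n → ℝ))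

/-!
The argument rests on a central character and on trace computations.

By Schur's lemma the centre `{(0, a)}` of `G` acts in `Y` through a sign character `ω` of `K`, and
`ω` is nontrivial on traces `t + t ^ q`, since otherwise all operators would commute
(`exists_centralCharacter`). As the commutator of `(u, a)` and `(v, b)` is `(0, f u v + f v u)`,
any representation with this central character has trace zero off the centre
(`HasCentralCharacter.trace_eq_zero`); so the representations affording the character of `Y` are
exactly those of degree `q ^ 2` with central character `ω`. A real one is induced from a maximal
abelian subgroup (`exists_real_representation`).

Let `U` be an isotropic line. The operators `X (u, 0)`, `u ∈ U`, commute, and by the trace formula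
they fix a single line; the translates of a fixed unit vector `z` under a complement of `U` form an
orthonormal eigenbasis (`HasCentralCharacter.exists_modelBasis`). The action of `G` on this basis
depends on `ω` only. Hence the commutant of `X` is scalar, and there is an isometry `T` from `X` to
`X ∘ σ̂` (`HasCentralCharacter.exists_isometry`). Then `T ^ (q + 1) = ± 1`, and since `q + 1` is odd
a change of sign gives `D`.

Now let `T = D ^ i` with `1 ≤ i ≤ q`, inducing `τ = σ ^ i`, and let `Z` be an eigenbasis of `U`. The
projection `P j` to the line of `Z j` is a signed average of the `X (u, 0)`, `u ∈ U`.
* If `0 ≠ u ∈ U`, some `X (b u₂, 0)` commutes with `T` and anticommutes with `X (u, 0)`, so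
  `T X (u, 0)` has trace zero. Thus every diagonal entry of `T` is `tr (P j T) = tr T / q ^ 2`.
* As `U ∩ τ U = 0`, the square of an entry, `tr (P j T P k T⁻¹)`, is `1 / q ^ 2`.

So `q T` is a Hadamard matrix and `tr (D ^ i) = ± q`. If `m` of these `q` signs are positive, the
fixed space of `D` has dimension `(q ^ 2 + (2 m - q) q) / (q + 1) = 2 q m / (q + 1)`. Since `q + 1`
is coprime to `2 q` and `m ≤ q`, this forces `m = 0` (`trace_pow_eq_neg_of_sq`): there are no fixed
vectors, all traces are `- q`, and all diagonal entries are `- 1 / q`.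
-/

open HGroup

/-! ### Commutators in the group and sign characters -/

section Group

variable {r : ℕ} {K V : Type*} [Field K] [CharP K 2] [AddCommGroup V] [Module K V]
  {f : SesqForm r K V}

theorem IsNondegHermitian.apply_ne_zero_comm (hf : IsNondegHermitian f) {u v : V}
    (h : f u v ≠ 0) : f v u ≠ 0 := by
  rw [hf.conj_symm]
  exact pow_ne_zero _ h

theorem IsNondegHermitian.exists_apply_ne_zero (hf : IsNondegHermitian f) {u : V} (hu : u ≠ 0) :
    ∃ v, f u v ≠ 0 := by
  by_contra! h
  exact hu (hf.nondeg u h)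

/-- The commutator of two elements of `G` is the central element given by the trace of the form. -/
theorem HGroup.mul_eq_central_mul (u v : V) (a b : K) :
    (⟨u, a⟩ * ⟨v, b⟩ : HGroup f) = ⟨0, f u v + f v u⟩ * (⟨v, b⟩ * ⟨u, a⟩) := by
  simp only [mul_def, map_zero, LinearMap.zero_apply, mk.injEq, zero_add]
  refine ⟨add_comm u v, ?_⟩
  linear_combination (-(f v u)) * (CharTwo.two_eq_zero : (2 : K) = 0)

theorem HGroup.central_mul_mk (v : V) (a b : K) :
    (⟨0, a⟩ * ⟨v, b⟩ : HGroup f) = ⟨v, a + b⟩ := by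
  simp [mul_def]

theorem HGroup.mk_mul_mk_of_isotropic {u v : V} (h : f u v = 0) :
    (⟨u, 0⟩ * ⟨v, 0⟩ : HGroup f) = ⟨u + v, 0⟩ := by
  simp [mul_def, h]

theorem AddChar.int_eq_one_or_neg_one (ω : AddChar K ℤ) (a : K) : ω a = 1 ∨ ω a = -1 := by
  have h : ω a * ω a = 1 := by
    rw [← AddChar.map_add_eq_mul, CharTwo.add_self_eq_zero, AddChar.map_zero_eq_one]
  exact mul_self_eq_one_iff.1 h

/-- A sign character of `K` is nontrivial on traces when it takes the value `-1` on some
`t + t ^ q`; for the central character of a representation of `G` this says that the representation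
does not factor through an abelian quotient. -/
def NontrivialOnTraces (r : ℕ) (ω : AddChar K ℤ) : Prop :=
  ∃ t : K, ω (t + t ^ (2 ^ r)) = -1

/-- Commutators with multiples of `w` realize the sign `-1` as soon as `f u w ≠ 0`. -/
theorem NontrivialOnTraces.exists_smul {ω : AddChar K ℤ} (hω : NontrivialOnTraces r ω)
    (hf : IsNondegHermitian f) {u w : V} (h : f u w ≠ 0) :
    ∃ c : K, ω (f (c • w) u + f u (c • w)) = -1 := by
  obtain ⟨t, ht⟩ := hω
  refine ⟨t / f w u, ?_⟩
  have h1 : f ((t / f w u) • w) u = t := by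
    simp [div_mul_cancel₀ _ (hf.apply_ne_zero_comm h)]
  rw [hf.conj_symm ((t / f w u) • w) u, h1, ht]

end Group

/-! ### Representations with a central character -/

section CentralCharacter

variable {r : ℕ} {K V : Type*} [Field K] [CharP K 2] [AddCommGroup V] [Module K V]
  {f : SesqForm r K V} {F E : Type*} [Field F] [AddCommGroup E] [Module F E]

/-- The elements `(0, a)` of the centre of `G` act through the sign character `ω`. -/
def HasCentralCharacter (X : Representation F (HGroup f) E) (ω : AddChar K ℤ) : Prop :=
  ∀ a : K, X ⟨0, a⟩ = (ω a : F) • (1 : E →ₗ[F] E)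

variable {X : Representation F (HGroup f) E} {ω : AddChar K ℤ}

theorem HasCentralCharacter.apply_mk (hX : HasCentralCharacter X ω) (v : V) (a : K) :
    X ⟨v, a⟩ = (ω a : F) • X ⟨v, 0⟩ := by
  have h : (⟨v, a⟩ : HGroup f) = ⟨0, a⟩ * ⟨v, 0⟩ := by simp [central_mul_mk]
  rw [h, map_mul, hX, smul_mul_assoc, one_mul]

theorem HasCentralCharacter.mul_comm_sign (hX : HasCentralCharacter X ω) (u v : V) (a b : K) :
    X ⟨u, a⟩ * X ⟨v, b⟩ = (ω (f u v + f v u) : F) • (X ⟨v, b⟩ * X ⟨u, a⟩) := by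
  rw [← map_mul, mul_eq_central_mul, map_mul, hX, smul_mul_assoc, one_mul, map_mul]

/-- An operator commuting with `X h`, multiplied by some `X g` that anticommutes with `X h`, is
conjugate to its negative and so has trace zero. -/
theorem HasCentralCharacter.trace_mul_eq_zero [CharZero F] (hX : HasCentralCharacter X ω)
    {T : E →ₗ[F] E} {u v : V} {a b : K} (hT : X ⟨v, b⟩ * T = T * X ⟨v, b⟩)
    (h : ω (f v u + f u v) = -1) :
    LinearMap.trace F E (T * X ⟨u, a⟩) = 0 := by
  have hinv : X ⟨v, b⟩ * X (⟨v, b⟩ : HGroup f)⁻¹ = 1 := by rw [← map_mul, mul_inv_cancel, map_one]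
  have hinv' : X (⟨v, b⟩ : HGroup f)⁻¹ * X ⟨v, b⟩ = 1 := by rw [← map_mul, inv_mul_cancel, map_one]
  have h1 : X ⟨v, b⟩ * (T * X ⟨u, a⟩) = -((T * X ⟨u, a⟩) * X ⟨v, b⟩) := by
    rw [← mul_assoc, hT, mul_assoc, hX.mul_comm_sign, h, mul_assoc]
    simp
  have h2 : LinearMap.trace F E (T * X ⟨u, a⟩) = -LinearMap.trace F E (T * X ⟨u, a⟩) := by
    calc LinearMap.trace F E (T * X ⟨u, a⟩)
        = LinearMap.trace F E ((X (⟨v, b⟩ : HGroup f)⁻¹ * X ⟨v, b⟩) * (T * X ⟨u, a⟩)) := by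
          rw [hinv', one_mul]
      _ = LinearMap.trace F E (X (⟨v, b⟩ : HGroup f)⁻¹ * -((T * X ⟨u, a⟩) * X ⟨v, b⟩)) := by
          rw [mul_assoc, h1]
      _ = -LinearMap.trace F E (T * X ⟨u, a⟩) := by
          rw [LinearMap.trace_mul_comm, neg_mul, mul_assoc, hinv, mul_one, map_neg]
  linear_combination h2 / 2

/-- The character vanishes off the centre. -/
theorem HasCentralCharacter.trace_eq_zero [CharZero F] (hX : HasCentralCharacter X ω)
    (hf : IsNondegHermitian f) (hω : NontrivialOnTraces r ω) {u : V} (hu : u ≠ 0) (a : K) :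
    LinearMap.trace F E (X ⟨u, a⟩) = 0 := by
  obtain ⟨w, hw⟩ := hf.exists_apply_ne_zero hu
  obtain ⟨c, hc⟩ := hω.exists_smul hf hw
  have := hX.trace_mul_eq_zero (T := 1) (a := a) (b := 0) (by rw [one_mul, mul_one]) hc
  rwa [one_mul] at this

end CentralCharacter

/-- Over a field of characteristic zero, an involution whose trace is `±` the dimension is the
corresponding scalar. -/
theorem LinearMap.eq_smul_one_of_mul_self_eq_one {F E : Type*} [Field F] [CharZero F]
    [AddCommGroup E] [Module F E] [FiniteDimensional F E] {A : E →ₗ[F] E} (hA : A * A = 1)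
    {s : F} (hs : s * s = 1) (htr : LinearMap.trace F E A = Module.finrank F E * s) :
    A = s • 1 := by
  -- `(1 - s A) / 2` is an idempotent of trace zero.
  set P : E →ₗ[F] E := (2⁻¹ : F) • (1 - s • A) with hP
  have hsq : (1 - s • A) * (1 - s • A) = (2 : F) • (1 - s • A) := by
    simp only [mul_sub, sub_mul, mul_one, one_mul, smul_mul_smul_comm, hA, hs, one_smul, two_smul]
    abel
  have hid : IsIdempotentElem P := by
    rw [IsIdempotentElem, hP, smul_mul_smul_comm, hsq, smul_smul]
    norm_num
  have h0 : LinearMap.trace F E P = 0 := by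
    rw [hP, map_smul, map_sub, map_smul, htr, LinearMap.trace_one]
    simp only [smul_eq_mul]
    linear_combination (-(2⁻¹ : F) * Module.finrank F E) * hs
  have hP0 : P = 0 := LinearMap.IsIdempotentElem.eq_zero_of_trace_eq_zero hid h0
  have h1 : (1 : E →ₗ[F] E) = s • A := by
    rw [hP, smul_eq_zero] at hP0
    exact sub_eq_zero.1 (hP0.resolve_left (by norm_num))
  rw [h1, smul_smul, hs, one_smul]

/-! ### The central character of an irreducible representation -/

section Irreducible

variable {r : ℕ} {K V : Type*} [Field K] [CharP K 2] [AddCommGroup V] [Module K V]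
  {f : SesqForm r K V}

/-- Schur's lemma for single operators. -/
theorem Representation.IsIrreducible.exists_eq_smul_one {G E : Type*} [Group G] [AddCommGroup E]
    [Module ℂ E] [FiniteDimensional ℂ E] {Y : Representation ℂ G E} (hY : Y.IsIrreducible)
    {A : E →ₗ[ℂ] E} (hA : ∀ g, A * Y g = Y g * A) : ∃ c : ℂ, A = c • 1 := by
  obtain ⟨c, hc⟩ :=
    (Representation.IsIrreducible.algebraMap_intertwiningMap_bijective_of_isAlgClosed
      (ρ := Y) (k := ℂ)).2 ⟨A, fun g => hA g⟩
  refine ⟨c, ?_⟩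
  have := congrArg (fun φ : Representation.IntertwiningMap Y Y => φ.toLinearMap) hc
  exact this.symm

/-- An irreducible complex representation of degree greater than one has a central character that
is nontrivial on traces: otherwise all operators would commute. -/
theorem exists_centralCharacter {n : ℕ} (hn : 1 < n)
    {Y : Representation ℂ (HGroup f) (Fin n → ℂ)} (hY : Y.IsIrreducible)
    (hf : IsNondegHermitian f) :
    ∃ ω : AddChar K ℤ, HasCentralCharacter Y ω ∧ NontrivialOnTraces r ω := by
  classical
  have h1 : ∀ a : K, ∃ c : ℂ, Y ⟨0, a⟩ = c • 1 := fun a =>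
    hY.exists_eq_smul_one fun g => by
      rw [← map_mul, ← map_mul]
      congr 1
      simp only [mul_def, map_zero, LinearMap.zero_apply, zero_add, add_zero, mk.injEq, true_and]
      exact add_comm _ _
  choose c hc using h1
  have : Nonempty (Fin n) := ⟨⟨0, by omega⟩⟩
  have hinj : ∀ x y : ℂ, x • (1 : (Fin n → ℂ) →ₗ[ℂ] (Fin n → ℂ)) = y • 1 → x = y :=
    fun x y h => smul_left_injective ℂ (one_ne_zero (α := (Fin n → ℂ) →ₗ[ℂ] (Fin n → ℂ))) h
  have hadd : ∀ a b, c (a + b) = c a * c b := fun a b => hinj _ _ <| by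
    rw [← hc, ← central_mul_mk, map_mul, hc, hc, smul_mul_smul_comm, one_mul]
  have hzero : c 0 = 1 := hinj _ _ <| by
    rw [← hc, one_smul, ← map_one Y]
    rfl
  have hsq : ∀ a, c a = 1 ∨ c a = -1 := fun a => by
    rw [← mul_self_eq_one_iff, ← hadd, CharTwo.add_self_eq_zero, hzero]
  let ω : K → ℤ := fun a => if c a = 1 then 1 else -1
  have hω : ∀ a, (ω a : ℂ) = c a := fun a => by
    rcases hsq a with h | h
    · simp [ω, h]
    · have : ¬ (-1 : ℂ) = 1 := by norm_num
      simp [ω, h, this]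
  let Ω : AddChar K ℤ :=
    { toFun := ω
      map_zero_eq_one' := by exact_mod_cast (hω 0).trans hzero
      map_add_eq_mul' := fun a b => by
        have : ((ω (a + b) : ℤ) : ℂ) = ((ω a * ω b : ℤ) : ℂ) := by
          push_cast
          rw [hω, hω, hω, hadd]
        exact_mod_cast this }
  have hΩ : HasCentralCharacter Y Ω := fun a => by
    rw [hc, ← hω]
    rfl
  refine ⟨Ω, hΩ, ?_⟩
  by_contra hcon
  have htriv : ∀ t, Ω (t + t ^ (2 ^ r)) = 1 := fun t =>
    (AddChar.int_eq_one_or_neg_one Ω _).resolve_right fun h => hcon ⟨t, h⟩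
  have hcomm : ∀ g h, Y g * Y h = Y h * Y g := fun ⟨u, a⟩ ⟨v, b⟩ => by
    rw [hΩ.mul_comm_sign, hf.conj_symm u v, htriv]
    simp
  have hscal : ∀ g, ∃ x : ℂ, Y g = x • 1 := fun g =>
    hY.exists_eq_smul_one fun h => hcomm g h
  -- All operators are scalar, so every line is invariant.
  let e₀ : Fin n → ℂ := Pi.single ⟨0, by omega⟩ 1
  let S : Subrepresentation Y :=
    { toSubmodule := Submodule.span ℂ {e₀}
      apply_mem_toSubmodule := fun g v hv => by
        obtain ⟨x, hx⟩ := hscal g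
        rw [hx]
        exact Submodule.smul_mem _ x hv }
  rcases eq_bot_or_eq_top S with h | h
  · have h' : S.toSubmodule = ⊥ := by rw [h]; rfl
    have h2 : e₀ = 0 := Submodule.span_singleton_eq_bot.1 h'
    simpa [e₀] using congrFun h2 ⟨0, by omega⟩
  · have h' : S.toSubmodule = ⊤ := by rw [h]; rfl
    have h2 : (Pi.single ⟨1, hn⟩ 1 : Fin n → ℂ) ∈ Submodule.span ℂ {e₀} := by
      change _ ∈ S.toSubmodule
      rw [h']
      trivial
    obtain ⟨x, hx⟩ := Submodule.mem_span_singleton.1 h2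
    simpa [e₀] using congrFun hx ⟨1, hn⟩

/-- A real representation affording the character of `Y` has the same central character. -/
theorem Affords.hasCentralCharacter {n : ℕ} {X : Representation ℝ (HGroup f) (Fin n → ℝ)}
    {Y : Representation ℂ (HGroup f) (Fin n → ℂ)} (hXY : Affords X Y) {ω : AddChar K ℤ}
    (hY : HasCentralCharacter Y ω) : HasCentralCharacter X ω := fun a => by
  have hs : (ω a : ℝ) * ω a = 1 := by
    rcases AddChar.int_eq_one_or_neg_one ω a with h | h <;> simp [h]
  refine LinearMap.eq_smul_one_of_mul_self_eq_one ?_ hs ?_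
  · rw [← map_mul, central_mul_mk, CharTwo.add_self_eq_zero, ← map_one X]
    rfl
  · have h := hXY ⟨0, a⟩
    simp only [Representation.character, hY a, map_smul, LinearMap.trace_one,
      Module.finrank_fin_fun, smul_eq_mul] at h
    rw [Module.finrank_fin_fun, mul_comm]
    exact_mod_cast h

/-- Representations with the same central character, nontrivial on traces, and the same degree have
the same character. -/
theorem HasCentralCharacter.affords {n : ℕ} {X : Representation ℝ (HGroup f) (Fin n → ℝ)}
    {Y : Representation ℂ (HGroup f) (Fin n → ℂ)} {ω : AddChar K ℤ}
    (hX : HasCentralCharacter X ω) (hY : HasCentralCharacter Y ω) (hf : IsNondegHermitian f)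
    (hω : NontrivialOnTraces r ω) : Affords X Y := fun ⟨u, a⟩ => by
  simp only [Representation.character]
  by_cases hu : u = 0
  · subst hu
    rw [hX, hY]
    simp
  · rw [hX.trace_eq_zero hf hω hu, hY.trace_eq_zero hf hω hu]
    simp

end Irreducible

/-! ### Isotropic lines -/

section Geometry

variable {r : ℕ} {K V : Type*} [Field K] [CharP K 2] [AddCommGroup V] [Module K V]
  {f : SesqForm r K V}

/-- An isotropic line has a generator `p` and a complementary line spanned by some `w`, which can be
any vector not orthogonal to `p`. -/
theorem IsIsotropicLine.exists_decomposition {U : Submodule K V} (hU : IsIsotropicLine f U)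
    (hf : IsNondegHermitian f) (hV : Module.finrank K V = 2) :
    ∃ p w : V, p ∈ U ∧ f p w ≠ 0 ∧ ∀ v, ∃ α β : K, v = α • p + β • w := by
  obtain ⟨⟨p, hpU⟩, hp, -⟩ := finrank_eq_one_iff'.1 hU.finrank_eq
  have hp0 : p ≠ 0 := fun h => hp (Subtype.ext h)
  obtain ⟨w, hw⟩ := hf.exists_apply_ne_zero hp0
  have hpp := hU.isotropic p hpU p hpU
  have hli : LinearIndependent K ![p, w] := by
    refine LinearIndependent.pair_iff.2 fun s t hst => ?_
    have h1 : t * f w p = 0 := by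
      have := congrArg (fun x => f x p) hst
      simpa [hpp] using this
    have ht : t = 0 := (mul_eq_zero.1 h1).resolve_right (hf.apply_ne_zero_comm hw)
    rw [ht, zero_smul, add_zero, smul_eq_zero] at hst
    exact ⟨hst.resolve_right hp0, ht⟩
  refine ⟨p, w, hpU, hw, fun v => ?_⟩
  have : FiniteDimensional K V := Module.finite_of_finrank_eq_succ hV
  have hspan := hli.span_eq_top_of_card_eq_finrank' (by simp [hV])
  have hv : v ∈ Submodule.span K (Set.range ![p, w]) := hspan ▸ Submodule.mem_top
  rw [Matrix.range_cons_cons_empty, Submodule.mem_span_pair] at hv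
  obtain ⟨α, β, h⟩ := hv
  exact ⟨α, β, h.symm⟩

theorem IsIsotropicLine.card_eq {U : Submodule K V} (hU : IsIsotropicLine f U) :
    Nat.card U = Nat.card K := by
  have : FiniteDimensional K U := Module.finite_of_finrank_eq_succ hU.finrank_eq
  rw [Module.natCard_eq_pow_finrank (K := K), hU.finrank_eq, pow_one]

end Geometry

/-! ### Real representations and invariant forms -/

section Existence

variable {r : ℕ} {K V : Type*} [Field K] [CharP K 2] [AddCommGroup V] [Module K V]
  {f : SesqForm r K V}

/-- The exponent of the cocycle describing the representation of `G` induced from the abelian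
subgroup `{(u, a) : u ∈ K p}` is compatible with multiplication; `(c + β) w` is the image of the
coset representative `c w` under an element with vector part `α p + β w`. -/
theorem induced_cocycle {p w : V} (hp : f p p = 0) {v v' : V} {α β α' β' : K}
    (hv : v = α • p + β • w) (hv' : v' = α' • p + β' • w) (a a' x : K) :
    (f v v' + a + a') + f (v + v') ((x + (β + β')) • w) + f (x • w) ((α + α') • p)
      = (a + f v ((x + β) • w) + f (x • w) (α • p))
        + (a' + f v' ((x + β + β') • w) + f ((x + β) • w) (α' • p)) := by
  have h1 : f v v' = f v (α' • p) + f v (β' • w) := by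
    conv_lhs => rw [hv']
    rw [map_add]
  have h2 : f v (α' • p) = f (β • w) (α' • p) := by
    conv_lhs => rw [hv]
    simp [hp]
  simp only [add_smul, map_add, LinearMap.add_apply]
  linear_combination h1 + h2 + f v (β' • w) * (CharTwo.two_eq_zero : (2 : K) = 0)

/-- Every sign character of the centre is the central character of a real representation of degree
`|K|`, namely of a monomial representation induced from a maximal abelian subgroup. -/
theorem exists_real_representation {n : ℕ} (ε : Fin n ≃ K) {p w : V} (hp : f p p = 0)
    (α β : V →ₗ[K] K) (hdec : ∀ v, v = α v • p + β v • w) (ω : AddChar K ℤ) :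
    ∃ X : Representation ℝ (HGroup f) (Fin n → ℝ), HasCentralCharacter X ω := by
  let A : HGroup f → (Fin n → ℝ) →ₗ[ℝ] (Fin n → ℝ) := fun g =>
    { toFun := fun φ i =>
        (ω (g.scal + f g.vec ((ε i + β g.vec) • w) + f (ε i • w) (α g.vec • p)) : ℝ)
          * φ (ε.symm (ε i + β g.vec))
      map_add' := fun φ ψ => by
        ext i
        simp [mul_add]
      map_smul' := fun c φ => by
        ext i
        simp only [Pi.smul_apply, smul_eq_mul, RingHom.id_apply]
        ring }
  refine ⟨{ toFun := A, map_one' := ?_, map_mul' := ?_ }, ?_⟩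
  · refine LinearMap.ext fun φ => funext fun i => ?_
    simp [A, one_def]
  · rintro ⟨v, a⟩ ⟨v', a'⟩
    refine LinearMap.ext fun φ => funext fun i => ?_
    have h := induced_cocycle hp (hdec v) (hdec v') a a' (ε i)
    simp only [A, mul_def, Module.End.mul_apply, LinearMap.coe_mk, AddHom.coe_mk, map_add α,
      map_add β, Equiv.apply_symm_apply]
    rw [h, AddChar.map_add_eq_mul, Int.cast_mul, mul_assoc, add_assoc (ε i)]
  · intro a
    refine LinearMap.ext fun φ => funext fun i => ?_
    simp [A]

/-- Averaging the standard inner product over the group. -/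
theorem exists_isInvariantForm {G : Type*} [Group G] [Finite G] {n : ℕ}
    (X : Representation ℝ G (Fin n → ℝ)) : ∃ B, IsInvariantForm X B := by
  classical
  have := Fintype.ofFinite G
  refine ⟨LinearMap.mk₂ ℝ (fun v w => ∑ g : G, X g v ⬝ᵥ X g w) ?_ ?_ ?_ ?_, ?_, ?_, ?_⟩
  · intro v v' w
    simp [add_dotProduct, Finset.sum_add_distrib]
  · intro c v w
    simp [Finset.mul_sum]
  · intro v w w'
    simp [dotProduct_add, Finset.sum_add_distrib]
  · intro c v w
    simp [Finset.mul_sum]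
  · intro v w
    simp only [LinearMap.mk₂_apply]
    exact Finset.sum_congr rfl fun g _ => dotProduct_comm _ _
  · intro v hv
    simp only [LinearMap.mk₂_apply]
    have hnn : ∀ x : Fin n → ℝ, 0 ≤ x ⬝ᵥ x := fun x =>
      Finset.sum_nonneg fun i _ => mul_self_nonneg (x i)
    refine Finset.sum_pos' (fun g _ => hnn _) ⟨1, Finset.mem_univ _, ?_⟩
    rw [map_one, Module.End.one_apply]
    exact lt_of_le_of_ne (hnn v) fun h => hv (dotProduct_self_eq_zero.1 h.symm)
  · intro h v w
    simp only [LinearMap.mk₂_apply]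
    refine Fintype.sum_equiv (Equiv.mulRight h) _ _ fun g => ?_
    simp

end Existence

/-! ### The model attached to an isotropic line -/

section Model

variable {r : ℕ} {K V : Type*} [Field K] [CharP K 2] [AddCommGroup V] [Module K V]
  {f : SesqForm r K V} {n : ℕ} {X : Representation ℝ (HGroup f) (Fin n → ℝ)} {ω : AddChar K ℤ}

/-- The vectors fixed by an isotropic subspace of order the degree form a line: the averaging
projection onto them has trace one. -/
theorem HasCentralCharacter.exists_fixed_vector (hX : HasCentralCharacter X ω)
    (hf : IsNondegHermitian f) (hω : NontrivialOnTraces r ω) {U : Submodule K V} [Finite U]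
    (hU : ∀ u ∈ U, ∀ v ∈ U, f u v = 0) (hcard : Nat.card U = n) :
    ∃ z : Fin n → ℝ, z ≠ 0 ∧ (∀ u ∈ U, X ⟨u, 0⟩ z = z) ∧
      ∀ y, (∀ u ∈ U, X ⟨u, 0⟩ y = y) → ∃ a : ℝ, y = a • z := by
  classical
  have := Fintype.ofFinite U
  rw [Nat.card_eq_fintype_card] at hcard
  have hn : (n : ℝ) ≠ 0 := by
    rw [← hcard]
    exact_mod_cast Fintype.card_ne_zero
  let W : Submodule ℝ (Fin n → ℝ) :=
    { carrier := {y | ∀ u ∈ U, X ⟨u, 0⟩ y = y}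
      add_mem' := fun {x y} hx hy u hu => by rw [map_add, hx u hu, hy u hu]
      zero_mem' := fun u _ => map_zero _
      smul_mem' := fun c y hy u hu => by rw [map_smul, hy u hu] }
  let P : (Fin n → ℝ) →ₗ[ℝ] (Fin n → ℝ) := (n : ℝ)⁻¹ • ∑ u : U, X ⟨(u : V), 0⟩
  have hP : LinearMap.IsProj W P := by
    refine ⟨fun y u hu => ?_, fun y hy => ?_⟩
    · simp only [P, LinearMap.smul_apply, LinearMap.sum_apply, map_smul, map_sum]
      congr 1
      refine Fintype.sum_equiv (Equiv.addLeft (⟨u, hu⟩ : U)) _ _ fun v => ?_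
      rw [← Module.End.mul_apply, ← map_mul, mk_mul_mk_of_isotropic (hU u hu v v.2)]
      rfl
    · simp only [P, LinearMap.smul_apply, LinearMap.sum_apply]
      rw [Finset.sum_congr rfl fun (v : U) _ => hy v v.2]
      simp only [Finset.sum_const, Finset.card_univ, hcard]
      rw [← Nat.cast_smul_eq_nsmul ℝ, smul_smul, inv_mul_cancel₀ hn, one_smul]
  have htr : LinearMap.trace ℝ _ P = 1 := by
    simp only [P, map_smul, map_sum]
    rw [Finset.sum_eq_single (0 : U)]
    · rw [ZeroMemClass.coe_zero, hX]
      simp [hn]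
    · intro u _ hu
      exact hX.trace_eq_zero hf hω (fun h => hu (Subtype.ext h)) 0
    · simp
  rw [hP.trace] at htr
  have hfin : Module.finrank ℝ W = 1 := by exact_mod_cast htr
  obtain ⟨⟨z, hzW⟩, hz, hspan⟩ := finrank_eq_one_iff'.1 hfin
  refine ⟨z, fun h => hz (Subtype.ext h), hzW, fun y hy => ?_⟩
  obtain ⟨a, ha⟩ := hspan ⟨y, hy⟩
  exact ⟨a, (congrArg Subtype.val ha).symm⟩

/-- The action of `G` on the vectors `X (c w, 0) z`, where `z` is fixed by the line through `p`. -/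
theorem HasCentralCharacter.apply_translate (hX : HasCentralCharacter X ω) {p w v : V}
    {α β : K} (hv : v = α • p + β • w) {z : Fin n → ℝ} (hz : X ⟨α • p, 0⟩ z = z) (a c : K) :
    X ⟨v, a⟩ (X ⟨c • w, 0⟩ z)
      = (ω (a + f v (c • w) + f ((c + β) • w) (α • p)) : ℝ) • X ⟨(c + β) • w, 0⟩ z := by
  have h : (⟨v, a⟩ * ⟨c • w, 0⟩ : HGroup f)
      = ⟨0, a + f v (c • w) + f ((c + β) • w) (α • p)⟩ * (⟨(c + β) • w, 0⟩ * ⟨α • p, 0⟩) := by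
    simp only [mul_def, map_zero, LinearMap.zero_apply, mk.injEq, zero_add, add_zero]
    refine ⟨by rw [hv, add_smul]; abel, ?_⟩
    linear_combination (-f ((c + β) • w) (α • p)) * (CharTwo.two_eq_zero : (2 : K) = 0)
  rw [← Module.End.mul_apply, ← map_mul, h, map_mul, map_mul, hX, Module.End.mul_apply,
    Module.End.mul_apply, hz, LinearMap.smul_apply, Module.End.one_apply]

/-- The vectors of the isotropic line `U` act on the translates of a `U`-fixed vector by signs. -/
theorem HasCentralCharacter.apply_translate_of_fixed (hX : HasCentralCharacter X ω) {u w : V}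
    {z : Fin n → ℝ} (hz : X ⟨u, 0⟩ z = z) :
    X ⟨u, 0⟩ (X ⟨w, 0⟩ z) = (ω (f u w + f w u) : ℝ) • X ⟨w, 0⟩ z := by
  rw [← Module.End.mul_apply, hX.mul_comm_sign, LinearMap.smul_apply, Module.End.mul_apply, hz]

/-- A `U`-fixed unit vector and its translates form an orthonormal basis: distinct translates belong
to distinct characters of `U`. -/
theorem HasCentralCharacter.exists_modelBasis [Finite K] [DecidableEq K]
    (hX : HasCentralCharacter X ω) (hf : IsNondegHermitian f) (hω : NontrivialOnTraces r ω)
    (hn : Nat.card K = n) {U : Submodule K V} (hU : IsIsotropicLine f U) {p w : V} (hp : p ∈ U)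
    (hw : f p w ≠ 0) {B : LinearMap.BilinForm ℝ (Fin n → ℝ)} (hB : IsInvariantForm X B) :
    ∃ b : Module.Basis K ℝ (Fin n → ℝ), (∀ c d, B (b c) (b d) = if c = d then 1 else 0) ∧
      (∀ c, b c = X ⟨c • w, 0⟩ (b 0)) ∧ (∀ u ∈ U, X ⟨u, 0⟩ (b 0) = b 0) ∧
      ∀ y, (∀ u ∈ U, X ⟨u, 0⟩ y = y) → ∃ a : ℝ, y = a • b 0 := by
  have := Fintype.ofFinite K
  have hUc := hU.card_eq.trans hn
  have : Finite U := Nat.finite_of_card_ne_zero (by rw [hU.card_eq]; exact Nat.card_pos.ne')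
  obtain ⟨y, hy0, hyfix, hyspan⟩ := hX.exists_fixed_vector hf hω hU.isotropic hUc
  have hpos := hB.pos y hy0
  set s : ℝ := (Real.sqrt (B y y))⁻¹ with hs
  have hsne : s ≠ 0 := inv_ne_zero (Real.sqrt_pos.2 hpos).ne'
  have hss : s * (s * B y y) = 1 := by
    rw [hs, ← mul_assoc, ← mul_inv, Real.mul_self_sqrt hpos.le, inv_mul_cancel₀ hpos.ne']
  set z := s • y with hz
  have hzfix : ∀ u ∈ U, X ⟨u, 0⟩ z = z := fun u hu => by rw [hz, map_smul, hyfix u hu]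
  have hzz : B z z = 1 := by
    simp only [hz, map_smul, LinearMap.smul_apply, smul_eq_mul, hss]
  have hort : ∀ c d : K, B (X ⟨c • w, 0⟩ z) (X ⟨d • w, 0⟩ z) = if c = d then 1 else 0 := by
    intro c d
    split_ifs with hcd
    · rw [hcd, hB.invariant, hzz]
    · -- Some `X (t p, 0)` has opposite eigenvalues on the two translates.
      have hne : f ((c - d) • w) p ≠ 0 := by
        rw [map_smul, LinearMap.smul_apply, smul_eq_mul]
        exact mul_ne_zero (sub_ne_zero.2 hcd) (hf.apply_ne_zero_comm hw)
      obtain ⟨t, ht⟩ := hω.exists_smul hf hne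
      have htU : t • p ∈ U := U.smul_mem t hp
      have h1 := hB.invariant ⟨t • p, 0⟩ (X ⟨c • w, 0⟩ z) (X ⟨d • w, 0⟩ z)
      rw [hX.apply_translate_of_fixed (hzfix _ htU), hX.apply_translate_of_fixed (hzfix _ htU)]
        at h1
      simp only [map_smul, LinearMap.smul_apply, smul_eq_mul] at h1
      have h2 : ω (f (t • p) (c • w) + f (c • w) (t • p))
          * ω (f (t • p) (d • w) + f (d • w) (t • p)) = -1 := by
        rw [← AddChar.map_add_eq_mul, ← ht]
        congr 1
        rw [sub_smul, map_sub, map_sub, LinearMap.sub_apply]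
        linear_combination (f (t • p) (d • w) + f (d • w) (t • p))
          * (CharTwo.two_eq_zero : (2 : K) = 0)
      have h3 : (ω (f (t • p) (c • w) + f (c • w) (t • p)) : ℝ)
          * ω (f (t • p) (d • w) + f (d • w) (t • p)) = -1 := by exact_mod_cast h2
      simp only [map_smul] at h3
      linear_combination (-1 / 2 : ℝ) * h1 + (B (X ⟨c • w, 0⟩ z) (X ⟨d • w, 0⟩ z)) / 2 * h3
  have hli : LinearIndependent ℝ fun c : K => X ⟨c • w, 0⟩ z := by
    refine LinearMap.BilinForm.linearIndependent_of_iIsOrtho (B := B) ?_ ?_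
    · intro c d hcd
      exact (hort c d).trans (if_neg hcd)
    · intro c hc
      have h1 : B (X ⟨c • w, 0⟩ z) (X ⟨c • w, 0⟩ z) = 0 := hc
      rw [hort, if_pos rfl] at h1
      exact one_ne_zero h1
  let b := basisOfLinearIndependentOfCardEqFinrank hli
    (by rw [Module.finrank_fin_fun, ← hn, Nat.card_eq_fintype_card])
  have hb : ∀ c, b c = X ⟨c • w, 0⟩ z := fun c => by
    simp only [b, coe_basisOfLinearIndependentOfCardEqFinrank]
  have hb0 : b 0 = z := by
    rw [hb, zero_smul, hX]
    simp
  refine ⟨b, fun c d => by rw [hb, hb, hort], fun c => by rw [hb0, hb], ?_, fun x hx => ?_⟩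
  · rwa [hb0]
  · obtain ⟨a, ha⟩ := hyspan x hx
    refine ⟨a * s⁻¹, ?_⟩
    rw [hb0, hz, smul_smul, mul_assoc, inv_mul_cancel₀ hsne, mul_one, ha]

/-- Only scalars commute with the representation. -/
theorem HasCentralCharacter.exists_eq_smul_of_commute [Finite K]
    (hX : HasCentralCharacter X ω) (hf : IsNondegHermitian f) (hω : NontrivialOnTraces r ω)
    (hV : Module.finrank K V = 2) (hn : Nat.card K = n) {U : Submodule K V}
    (hU : IsIsotropicLine f U) {B : LinearMap.BilinForm ℝ (Fin n → ℝ)} (hB : IsInvariantForm X B)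
    {A : (Fin n → ℝ) →ₗ[ℝ] (Fin n → ℝ)} (hA : ∀ g v, A (X g v) = X g (A v)) :
    ∃ a : ℝ, ∀ v, A v = a • v := by
  classical
  obtain ⟨p, w, hp, hw, -⟩ := hU.exists_decomposition hf hV
  obtain ⟨b, -, hb, hfix, hspan⟩ := hX.exists_modelBasis hf hω hn hU hp hw hB
  obtain ⟨a, ha⟩ := hspan (A (b 0)) fun u hu => by rw [← hA, hfix u hu]
  refine ⟨a, fun v => ?_⟩
  have : A = a • 1 := b.ext fun c => by
    rw [hb, hA, ha, map_smul]
    rfl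
  rw [this]
  rfl

/-- Uniqueness of the orthogonal representation with a given central character: two such
representations preserving the same form are intertwined by an isometry. -/
theorem HasCentralCharacter.exists_isometry [Finite K]
    {X' : Representation ℝ (HGroup f) (Fin n → ℝ)}
    (hX : HasCentralCharacter X ω) (hX' : HasCentralCharacter X' ω) (hf : IsNondegHermitian f)
    (hω : NontrivialOnTraces r ω) (hV : Module.finrank K V = 2) (hn : Nat.card K = n)
    {U : Submodule K V} (hU : IsIsotropicLine f U) {B : LinearMap.BilinForm ℝ (Fin n → ℝ)}
    (hB : IsInvariantForm X B) (hB' : IsInvariantForm X' B) :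
    ∃ T : (Fin n → ℝ) ≃ₗ[ℝ] (Fin n → ℝ), (∀ g v, X' g (T v) = T (X g v)) ∧
      ∀ v w, B (T v) (T w) = B v w := by
  classical
  obtain ⟨p, w, hp, hw, hdec⟩ := hU.exists_decomposition hf hV
  obtain ⟨b, hort, hb, hfix, -⟩ := hX.exists_modelBasis hf hω hn hU hp hw hB
  obtain ⟨b', hort', hb', hfix', -⟩ := hX'.exists_modelBasis hf hω hn hU hp hw hB'
  let T := b.equiv b' (Equiv.refl K)
  have hT : ∀ c, T (b c) = b' c := fun c => by simp [T]
  refine ⟨T, fun g v => ?_, fun v v' => ?_⟩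
  · obtain ⟨x, a⟩ := g
    obtain ⟨α, β, hx⟩ := hdec x
    have h1 : X' ⟨x, a⟩ ∘ₗ T.toLinearMap = T.toLinearMap ∘ₗ X ⟨x, a⟩ := b.ext fun c => by
      have hα := U.smul_mem α hp
      simp only [LinearMap.comp_apply, LinearEquiv.coe_coe, hT]
      rw [hb' c, hb c, hX'.apply_translate hx (hfix' _ hα), hX.apply_translate hx (hfix _ hα),
        T.map_smul, ← hb, ← hb', hT]
    exact LinearMap.congr_fun h1 v
  · have h1 : B.compl₁₂ T.toLinearMap T.toLinearMap = B := b.ext fun c => b.ext fun d => by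
      simp only [LinearMap.compl₁₂_apply, LinearEquiv.coe_coe, hT]
      rw [hort, hort']
    exact LinearMap.congr_fun₂ h1 v v'

/-- The orthonormal eigenbasis of an isotropic line. -/
theorem HasCentralCharacter.exists_isEigenbasis [Finite K]
    (hX : HasCentralCharacter X ω) (hf : IsNondegHermitian f) (hω : NontrivialOnTraces r ω)
    (hV : Module.finrank K V = 2) (hn : Nat.card K = n) {U : Submodule K V}
    (hU : IsIsotropicLine f U) {B : LinearMap.BilinForm ℝ (Fin n → ℝ)}
    (hB : IsInvariantForm X B) : ∃ Z, IsEigenbasis X B U Z := by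
  classical
  obtain ⟨p, w, hp, hw, -⟩ := hU.exists_decomposition hf hV
  obtain ⟨b, hort, hb, hfix, -⟩ := hX.exists_modelBasis hf hω hn hU hp hw hB
  let ε : K ≃ Fin n := Finite.equivFinOfCardEq hn
  refine ⟨b.reindex ε, fun i j => ?_, fun u hu i => ?_⟩
  · simp [hort]
  · rw [Module.Basis.reindex_apply, hb]
    exact ⟨_, hX.apply_translate_of_fixed (hfix u hu)⟩

end Model

/-! ### The isometry of the plane and its lift to the group -/

section SigmaMap

variable {K V : Type*} [Field K] [AddCommGroup V] [Module K V] (e : Module.Basis (Fin 2) K V)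

theorem Module.Basis.exists_eq_smul_add_smul (v : V) : ∃ α β : K, v = α • e 0 + β • e 1 :=
  ⟨e.repr v 0, e.repr v 1, by rw [← Fin.sum_univ_two fun i => e.repr v i • e i, e.sum_repr]⟩

@[simp] theorem sigmaMap_zero (a : K) : sigmaMap e a (e 0) = a • e 0 := by simp [sigmaMap]

@[simp] theorem sigmaMap_one (a : K) : sigmaMap e a (e 1) = e 1 := by simp [sigmaMap]

theorem sigmaMap_comp (a b : K) : sigmaMap e a ∘ₗ sigmaMap e b = sigmaMap e (a * b) :=
  e.ext fun i => by fin_cases i <;> simp [smul_smul, mul_comm]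

theorem sigmaMap_eq_id : sigmaMap e (1 : K) = LinearMap.id :=
  e.ext fun i => by fin_cases i <;> simp

end SigmaMap

section Sigma

variable {r : ℕ} {K V : Type*} [Field K] [CharP K 2] [AddCommGroup V] [Module K V]
  {f : SesqForm r K V} (e : Module.Basis (Fin 2) K V)

theorem hatMap_sigmaMap_mul (a b : K) (x : HGroup f) :
    hatMap (sigmaMap e (a * b)) x = hatMap (sigmaMap e a) (hatMap (sigmaMap e b) x) := by
  simp [hatMap, ← sigmaMap_comp]

theorem hatMap_sigmaMap_eq_self (x : HGroup f) : hatMap (sigmaMap e (1 : K)) x = x := by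
  simp [hatMap, sigmaMap_eq_id]

variable {e}

theorem sesqForm_apply_of_orthonormal (he : ∀ i j, f (e i) (e j) = if i = j then 1 else 0)
    (α β α' β' : K) :
    f (α • e 0 + β • e 1) (α' • e 0 + β' • e 1) = α * α' ^ 2 ^ r + β * β' ^ 2 ^ r := by
  simp [he, iterateFrobenius_def]

theorem sesqForm_sigmaMap (he : ∀ i j, f (e i) (e j) = if i = j then 1 else 0) {a : K}
    (ha : a * a ^ 2 ^ r = 1) (v w : V) : f (sigmaMap e a v) (sigmaMap e a w) = f v w := by
  obtain ⟨α, β, rfl⟩ := e.exists_eq_smul_add_smul v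
  obtain ⟨α', β', rfl⟩ := e.exists_eq_smul_add_smul w
  have h : ∀ x y : K, sigmaMap e a (x • e 0 + y • e 1) = (x * a) • e 0 + y • e 1 := fun x y => by
    rw [map_add, map_smul, map_smul, sigmaMap_zero, sigmaMap_one, smul_smul]
  rw [h, h, sesqForm_apply_of_orthonormal he, sesqForm_apply_of_orthonormal he, mul_pow]
  linear_combination (α * α' ^ 2 ^ r) * ha

/-- The coordinates of a nonzero isotropic vector do not vanish. -/
theorem coord_ne_zero_of_isotropic (he : ∀ i j, f (e i) (e j) = if i = j then 1 else 0) {α β : K}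
    (hu : α • e 0 + β • e 1 ≠ 0) (hiso : f (α • e 0 + β • e 1) (α • e 0 + β • e 1) = 0) :
    α ≠ 0 ∧ β ≠ 0 := by
  rw [sesqForm_apply_of_orthonormal he] at hiso
  have h2 : 2 ^ r ≠ 0 := by positivity
  constructor
  · rintro rfl
    have hβ : β = 0 := by simpa [h2] using hiso
    exact hu (by simp [hβ])
  · rintro rfl
    have hα : α = 0 := by simpa [h2] using hiso
    exact hu (by simp [hα])

theorem apply_ne_zero_of_isotropic (he : ∀ i j, f (e i) (e j) = if i = j then 1 else 0) {u : V}
    (hu : u ≠ 0) (hiso : f u u = 0) : f u (e 1) ≠ 0 := by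
  obtain ⟨α, β, rfl⟩ := e.exists_eq_smul_add_smul u
  have h := coord_ne_zero_of_isotropic he hu hiso
  have h1 := sesqForm_apply_of_orthonormal he α β 0 1
  rw [zero_smul, one_smul, zero_add] at h1
  rw [h1]
  simpa using h.2

/-- A map `α u₁ + β u₂ ↦ α κ u₁ + β u₂` with `κ ≠ 1` moves every totally isotropic subspace to a
subspace meeting it trivially. -/
theorem eq_zero_of_sigmaMap_mem (he : ∀ i j, f (e i) (e j) = if i = j then 1 else 0)
    {U : Submodule K V} (hU : ∀ u ∈ U, ∀ v ∈ U, f u v = 0) {κ : K} (hκ : κ ≠ 1) {w : V}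
    (hw : w ∈ U) (hσ : sigmaMap e κ w ∈ U) : w = 0 := by
  by_contra h0
  obtain ⟨α, β, rfl⟩ := e.exists_eq_smul_add_smul w
  have h := coord_ne_zero_of_isotropic he h0 (hU _ hw _ hw)
  have h1 := hU _ hw _ hw
  have h2 := hU _ hσ _ hw
  have h3 : sigmaMap e κ (α • e 0 + β • e 1) = (α * κ) • e 0 + β • e 1 := by
    simp [smul_smul]
  rw [h3, sesqForm_apply_of_orthonormal he] at h2
  rw [sesqForm_apply_of_orthonormal he] at h1
  have h4 : (κ - 1) * (α * α ^ 2 ^ r) = 0 := by linear_combination h2 - h1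
  rcases mul_eq_zero.1 h4 with h5 | h5
  · exact hκ (sub_eq_zero.1 h5)
  · exact mul_ne_zero h.1 (pow_ne_zero _ h.1) h5

/-- The line through `u₁ + u₂` is isotropic. -/
theorem isIsotropicLine_span_add (he : ∀ i j, f (e i) (e j) = if i = j then 1 else 0) :
    IsIsotropicLine f (Submodule.span K {e 0 + e 1}) := by
  have h0 : e 0 + e 1 ≠ 0 := fun h => by
    simpa using congrArg (fun v => e.repr v 0) h
  have hiso : f (e 0 + e 1) (e 0 + e 1) = 0 := by
    have := sesqForm_apply_of_orthonormal he 1 1 1 1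
    simp only [one_smul] at this
    rw [this]
    simp [CharTwo.add_self_eq_zero]
  refine ⟨finrank_span_singleton h0, fun u hu v hv => ?_⟩
  obtain ⟨a, rfl⟩ := Submodule.mem_span_singleton.1 hu
  obtain ⟨b, rfl⟩ := Submodule.mem_span_singleton.1 hv
  simp only [LinearMap.map_smulₛₗ, LinearMap.smul_apply, hiso, smul_zero]

/-- The automorphism of `G` induced by an isometry of `V`. -/
def hatHom (τ : V →ₗ[K] V) (hτ : ∀ v w, f (τ v) (τ w) = f v w) : HGroup f →* HGroup f where
  toFun := hatMap τ
  map_one' := by simp [hatMap, one_def]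
  map_mul' x y := by simp [hatMap, mul_def, hτ]

end Sigma

/-! ### The normalizing isometry -/

section Normalizer

variable {r : ℕ} {K V : Type*} [Field K] [CharP K 2] [AddCommGroup V] [Module K V]
  {f : SesqForm r K V} {n : ℕ} {X : Representation ℝ (HGroup f) (Fin n → ℝ)} {ω : AddChar K ℤ}
  {e : Module.Basis (Fin 2) K V} {B : LinearMap.BilinForm ℝ (Fin n → ℝ)}

theorem apply_hatMap_pow {T : (Fin n → ℝ) ≃ₗ[ℝ] (Fin n → ℝ)} {a : K}
    (hT : ∀ x v, X (hatMap (sigmaMap e a) x) (T v) = T (X x v)) (i : ℕ) :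
    ∀ x v, X (hatMap (sigmaMap e (a ^ i)) x) ((T ^ i) v) = (T ^ i) (X x v) := by
  induction i with
  | zero =>
    intro x v
    rw [pow_zero, pow_zero, hatMap_sigmaMap_eq_self]
    rfl
  | succ i ih =>
    intro x v
    rw [pow_succ' a, pow_succ', hatMap_sigmaMap_mul, LinearEquiv.mul_apply, hT, ih,
      LinearEquiv.mul_apply]

theorem isometry_pow {T : (Fin n → ℝ) ≃ₗ[ℝ] (Fin n → ℝ)} (hT : ∀ v w, B (T v) (T w) = B v w)
    (i : ℕ) : ∀ v w, B ((T ^ i) v) ((T ^ i) w) = B v w := by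
  induction i with
  | zero => intro v w; rfl
  | succ i ih =>
    intro v w
    rw [pow_succ', LinearEquiv.mul_apply, LinearEquiv.mul_apply, hT, ih]

/-- An isometric intertwiner `T` between `X` and `X ∘ σ̂` has `T ^ (q + 1) = ± 1` by Schur's lemma;
since `q + 1` is odd, the sign can be absorbed into `T`. -/
theorem HasCentralCharacter.exists_isNormalizer [Finite K] (hX : HasCentralCharacter X ω)
    (hf : IsNondegHermitian f) (hω : NontrivialOnTraces r ω) (hV : Module.finrank K V = 2)
    (hn : Nat.card K = n) (he : ∀ i j, f (e i) (e j) = if i = j then 1 else 0)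
    (hB : IsInvariantForm X B) {a : K} {q : ℕ} (hq : q = 2 ^ r) (heven : Even q)
    (ha : a ^ (q + 1) = 1) :
    ∃ D, IsNormalizer X B (hatMap (sigmaMap e a)) (q + 1) D := by
  have hiso : ∀ v w, f (sigmaMap e a v) (sigmaMap e a w) = f v w :=
    sesqForm_sigmaMap he (by rw [← hq, ← pow_succ', ha])
  have hU := isIsotropicLine_span_add (f := f) he
  let X' : Representation ℝ (HGroup f) (Fin n → ℝ) := MonoidHom.comp X (hatHom (sigmaMap e a) hiso)
  have hX'X : ∀ g, X' g = X (hatMap (sigmaMap e a) g) := fun g => rfl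
  have hX' : HasCentralCharacter X' ω := fun c => by
    rw [hX'X, ← hX c]
    simp [hatMap]
  have hB' : IsInvariantForm X' B := ⟨hB.symm, hB.pos, fun g => hB.invariant _⟩
  obtain ⟨T, hT, hTB⟩ := hX.exists_isometry hX' hf hω hV hn hU hB hB'
  have hTpow := apply_hatMap_pow (X := X) (e := e) (a := a) (T := T) hT
  obtain ⟨c, hc⟩ := hX.exists_eq_smul_of_commute hf hω hV hn hU hB
    (A := ((T ^ (q + 1) : (Fin n → ℝ) ≃ₗ[ℝ] (Fin n → ℝ)) : (Fin n → ℝ) →ₗ[ℝ] (Fin n → ℝ)))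
    fun g v => by
      have := hTpow (q + 1) g v
      rw [ha, hatMap_sigmaMap_eq_self] at this
      exact this.symm
  have hc' : ∀ v, (T ^ (q + 1)) v = c • v := hc
  have hcc : c * c = 1 := by
    have hnpos : 0 < n := hn ▸ Nat.card_pos
    have : Nonempty (Fin n) := ⟨⟨0, hnpos⟩⟩
    obtain ⟨v, hv⟩ := exists_ne (0 : Fin n → ℝ)
    have h1 := isometry_pow hTB (q + 1) v v
    rw [hc'] at h1
    simp only [map_smul, LinearMap.smul_apply, smul_eq_mul] at h1
    have h2 := hB.pos v hv
    have h3 : (c * c - 1) * B v v = 0 := by linear_combination h1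
    rcases mul_eq_zero.1 h3 with h | h
    · linarith
    · exact absurd h h2.ne'
  -- As `c ^ 2 = 1`, rescaling by `c` preserves isometry and gives `c ^ (q + 2) = 1` in place of `c`.
  have hc0 : c ≠ 0 := left_ne_zero_of_mul_eq_one hcc
  let D : (Fin n → ℝ) ≃ₗ[ℝ] (Fin n → ℝ) := T.trans (LinearEquiv.smulOfNeZero ℝ _ c hc0)
  have hD : ∀ v, D v = c • T v := fun v => rfl
  have hDpow : ∀ (i : ℕ) v, (D ^ i) v = c ^ i • (T ^ i) v := by
    intro i
    induction i with
    | zero => intro v; simp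
    | succ i ih =>
      intro v
      rw [pow_succ', LinearEquiv.mul_apply, ih, hD, map_smul, smul_smul, ← pow_succ', pow_succ' T,
        LinearEquiv.mul_apply]
  refine ⟨D, fun x v => ?_, LinearEquiv.ext fun v => ?_, fun v w => ?_⟩
  · have h1 : X (hatMap (sigmaMap e a) x) (D (D.symm v)) = D (X x (D.symm v)) := by
      rw [hD, hD, map_smul, ← hX'X, hT]
    rwa [LinearEquiv.apply_symm_apply] at h1
  · obtain ⟨k, rfl⟩ := heven
    rw [hDpow, hc', smul_smul, ← pow_succ]
    have h1 : c ^ (k + k + 1 + 1) = 1 := by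
      rw [show k + k + 1 + 1 = 2 * (k + 1) by ring, pow_mul, pow_two, hcc, one_pow]
    rw [h1, one_smul]
    rfl
  · rw [hD, hD, map_smul, map_smul, LinearMap.smul_apply, smul_smul, hTB, hcc, one_smul]

end Normalizer

/-! ### Matrix entries in an eigenbasis -/

section Entries

variable {r : ℕ} {K V : Type*} [Field K] [CharP K 2] [AddCommGroup V] [Module K V]
  {f : SesqForm r K V} {n : ℕ} {X : Representation ℝ (HGroup f) (Fin n → ℝ)} {ω : AddChar K ℤ}
  {e : Module.Basis (Fin 2) K V} {B : LinearMap.BilinForm ℝ (Fin n → ℝ)}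
  {U : Submodule K V} {Z : Module.Basis (Fin n) ℝ (Fin n → ℝ)}

theorem IsEigenbasis.repr_eq (hZ : IsEigenbasis X B U Z) (v : Fin n → ℝ) (j : Fin n) :
    Z.repr v j = B (Z j) v := by
  conv_rhs => rw [← Z.sum_repr v]
  simp only [map_sum, map_smul, hZ.orthonormal, smul_eq_mul, mul_ite, mul_one, mul_zero,
    Finset.sum_ite_eq, Finset.mem_univ, if_true]

theorem IsEigenbasis.form_eq_sum (hZ : IsEigenbasis X B U Z) (v w : Fin n → ℝ) :
    B v w = ∑ l, Z.repr v l * Z.repr w l := by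
  conv_lhs => rw [← Z.sum_repr v]
  simp only [map_sum, map_smul, LinearMap.sum_apply, LinearMap.smul_apply, smul_eq_mul,
    hZ.repr_eq w]

/-- The `X (u, 0)`, `u ∈ U`, act on a common eigenbasis through pairwise distinct characters, so
averaging against one of these characters projects onto a coordinate line. -/
theorem HasCentralCharacter.exists_projection [Fintype U]
    (hX : HasCentralCharacter X ω) (hf : IsNondegHermitian f) (hω : NontrivialOnTraces r ω)
    (hU : ∀ u ∈ U, ∀ v ∈ U, f u v = 0) (hcard : Nat.card U = n)
    (hZ : ∀ u ∈ U, ∀ i, ∃ c : ℝ, X ⟨u, 0⟩ (Z i) = c • Z i) :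
    ∃ ψ : U → Fin n → ℝ, (∀ j, ψ 0 j = 1) ∧
      ∀ j v, (∑ u : U, ψ u j • X ⟨(u : V), 0⟩) v = (n * Z.repr v j) • Z j := by
  classical
  rw [Nat.card_eq_fintype_card] at hcard
  choose c hc using hZ
  let ψ : U → Fin n → ℝ := fun u i => c u u.2 i
  have hψ : ∀ (u : U) i, X ⟨(u : V), 0⟩ (Z i) = ψ u i • Z i := fun u i => hc u u.2 i
  have hinj : ∀ {a b : ℝ} i, a • Z i = b • Z i → a = b := fun i h =>
    smul_left_injective ℝ (Z.ne_zero i) h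
  have hzero : ∀ i, ψ 0 i = 1 := fun i => hinj i <| by
    rw [← hψ, ZeroMemClass.coe_zero, hX]
    simp
  have hadd : ∀ (u v : U) i, ψ (u + v) i = ψ u i * ψ v i := fun u v i => hinj i <| by
    rw [← hψ, Submodule.coe_add, ← mk_mul_mk_of_isotropic (hU u u.2 v v.2), map_mul,
      Module.End.mul_apply, hψ, map_smul, hψ, smul_smul, mul_comm]
  have hsq : ∀ (u : U) i, ψ u i * ψ u i = 1 := fun u i => by
    have h0 : u + u = 0 := vec_add_self K u
    rw [← hadd, h0, hzero]
  -- The character sums are `n` or `0`; their total is a trace, which is `n`.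
  have hsum : ∀ j k, (∑ u : U, ψ u j * ψ u k = n) ∨ (∑ u : U, ψ u j * ψ u k = 0) := fun j k => by
    by_cases h : ∀ u, ψ u j * ψ u k = 1
    · left
      simp [h, hcard]
    · right
      push Not at h
      obtain ⟨u₀, hu₀⟩ := h
      have h1 : ψ u₀ j * ψ u₀ k * ∑ u : U, ψ u j * ψ u k = ∑ u : U, ψ u j * ψ u k := by
        rw [Finset.mul_sum]
        refine Fintype.sum_equiv (Equiv.addLeft u₀) _ _ fun u => ?_
        rw [Equiv.coe_addLeft, hadd, hadd]
        ring
      have h2 : (ψ u₀ j * ψ u₀ k - 1) * ∑ u : U, ψ u j * ψ u k = 0 := by linear_combination h1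
      exact (mul_eq_zero.1 h2).resolve_left (sub_ne_zero.2 hu₀)
  have hQ : ∀ j k, (∑ u : U, ψ u j • X ⟨(u : V), 0⟩) (Z k) = (∑ u : U, ψ u j * ψ u k) • Z k :=
    fun j k => by
      rw [LinearMap.sum_apply, Finset.sum_smul]
      exact Finset.sum_congr rfl fun u _ => by rw [LinearMap.smul_apply, hψ, smul_smul]
  have htr : ∀ j, ∑ k, ∑ u : U, ψ u j * ψ u k = n := fun j => by
    have h1 : LinearMap.trace ℝ _ (∑ u : U, ψ u j • X ⟨(u : V), 0⟩) = n := by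
      rw [map_sum, Finset.sum_eq_single (0 : U)]
      · rw [ZeroMemClass.coe_zero, hX, hzero]
        simp
      · intro u _ hu
        rw [map_smul, hX.trace_eq_zero hf hω (fun h => hu (Subtype.ext h)), smul_zero]
      · simp
    rw [LinearMap.trace_eq_matrix_trace ℝ Z, Matrix.trace] at h1
    rw [← h1]
    refine Finset.sum_congr rfl fun k _ => ?_
    rw [Matrix.diag_apply, LinearMap.toMatrix_apply, hQ]
    simp
  have hdiag : ∀ j, ∑ u : U, ψ u j * ψ u j = n := fun j => by
    simp [hsq, hcard]
  have hoff : ∀ j k, k ≠ j → ∑ u : U, ψ u j * ψ u k = 0 := fun j k hkj => by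
    have h1 := htr j
    rw [← Finset.add_sum_erase _ _ (Finset.mem_univ j), hdiag, add_eq_left,
      Finset.sum_eq_zero_iff_of_nonneg] at h1
    · exact h1 k (Finset.mem_erase.2 ⟨hkj, Finset.mem_univ _⟩)
    · intro l _
      rcases hsum j l with h | h <;> rw [h]
      positivity
  refine ⟨ψ, hzero, fun j v => ?_⟩
  conv_lhs => rw [← Z.sum_repr v]
  rw [map_sum, Finset.sum_eq_single j]
  · rw [map_smul, hQ, hdiag, smul_smul, mul_comm]
  · intro k _ hkj
    rw [map_smul, hQ, hoff j k hkj, zero_smul, smul_zero]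
  · simp

theorem trace_mul_of_apply_eq {Q : (Fin n → ℝ) →ₗ[ℝ] (Fin n → ℝ)} {j : Fin n} {c : ℝ}
    (hQ : ∀ v, Q v = (c * Z.repr v j) • Z j) (M : (Fin n → ℝ) →ₗ[ℝ] (Fin n → ℝ)) :
    LinearMap.trace ℝ _ (M * Q) = c * Z.repr (M (Z j)) j := by
  classical
  rw [LinearMap.trace_eq_matrix_trace ℝ Z, Matrix.trace, Finset.sum_eq_single j]
  · rw [Matrix.diag_apply, LinearMap.toMatrix_apply, Module.End.mul_apply, hQ, map_smul, map_smul]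
    simp
  · intro k _ hkj
    rw [Matrix.diag_apply, LinearMap.toMatrix_apply, Module.End.mul_apply, hQ, map_smul, map_smul]
    simp [hkj.symm]
  · simp

variable {T : (Fin n → ℝ) ≃ₗ[ℝ] (Fin n → ℝ)} {κ : K}

/-- In an eigenbasis of an isotropic line, the operator inducing `(u, a) ↦ (τ u, a)` has constant
diagonal: `T X (u, 0)` has trace zero for `0 ≠ u ∈ U`, as it anticommutes with some `X (b u₂, 0)`,
which commutes with `T`. -/
theorem HasCentralCharacter.mul_diag_eq_trace [Finite K]
    (hX : HasCentralCharacter X ω) (hf : IsNondegHermitian f) (hω : NontrivialOnTraces r ω)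
    (hn : Nat.card K = n) (he : ∀ i j, f (e i) (e j) = if i = j then 1 else 0)
    (hU : IsIsotropicLine f U) (hZ : IsEigenbasis X B U Z)
    (hT : ∀ x v, X (hatMap (sigmaMap e κ) x) (T v) = T (X x v)) (j : Fin n) :
    n * Z.repr (T (Z j)) j = LinearMap.trace ℝ _ (T : (Fin n → ℝ) →ₗ[ℝ] (Fin n → ℝ)) := by
  classical
  have : Finite U := Nat.finite_of_card_ne_zero (by rw [hU.card_eq]; exact Nat.card_pos.ne')
  have := Fintype.ofFinite U
  obtain ⟨ψ, hψ0, hψ⟩ :=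
    hX.exists_projection hf hω hU.isotropic (hU.card_eq.trans hn) hZ.eigen
  have h := trace_mul_of_apply_eq (hψ j) (T : (Fin n → ℝ) →ₗ[ℝ] (Fin n → ℝ))
  rw [LinearEquiv.coe_coe] at h
  rw [← h, Finset.mul_sum, map_sum, Finset.sum_eq_single (0 : U)]
  · rw [hψ0, one_smul, ZeroMemClass.coe_zero, hX]
    simp
  · intro u _ hu
    have hu0 : (u : V) ≠ 0 := fun h => hu (Subtype.ext h)
    obtain ⟨b, hb⟩ := hω.exists_smul hf
      (apply_ne_zero_of_isotropic he hu0 (hU.isotropic u u.2 u u.2))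
    rw [mul_smul_comm, map_smul, hX.trace_mul_eq_zero (b := 0) _ hb, smul_zero]
    refine LinearMap.ext fun v => ?_
    have h1 := hT ⟨b • e 1, 0⟩ v
    simp only [hatMap, map_smul, sigmaMap_one] at h1
    exact h1
  · simp

/-- In an eigenbasis of an isotropic line `U`, all entries of an isometry inducing a map `τ` that
moves `U` have the same absolute value: the square of an entry is the trace of a product of two
rank-one projections, belonging to characters of `U` and of `τ U`. -/
theorem HasCentralCharacter.mul_sq_entry_eq_one [Finite K]
    (hX : HasCentralCharacter X ω) (hf : IsNondegHermitian f) (hω : NontrivialOnTraces r ω)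
    (hn : Nat.card K = n) (he : ∀ i j, f (e i) (e j) = if i = j then 1 else 0)
    (hU : IsIsotropicLine f U) (hB : IsInvariantForm X B) (hZ : IsEigenbasis X B U Z)
    (hκ : κ ≠ 1) (hT : ∀ x v, X (hatMap (sigmaMap e κ) x) (T v) = T (X x v))
    (hTB : ∀ v w, B (T v) (T w) = B v w) (j k : Fin n) :
    n * (Z.repr (T (Z k)) j) ^ 2 = 1 := by
  classical
  have : Finite U := Nat.finite_of_card_ne_zero (by rw [hU.card_eq]; exact Nat.card_pos.ne')
  have := Fintype.ofFinite U
  have hn0 : (n : ℝ) ≠ 0 := by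
    rw [← hn]
    exact_mod_cast Nat.card_pos.ne'
  obtain ⟨ψ, hψ0, hψ⟩ :=
    hX.exists_projection hf hω hU.isotropic (hU.card_eq.trans hn) hZ.eigen
  set Q : Fin n → (Fin n → ℝ) →ₗ[ℝ] (Fin n → ℝ) := fun j => ∑ u : U, ψ u j • X ⟨(u : V), 0⟩
    with hQdef
  -- `M` is the conjugate of `Q k` by `T`.
  set M : (Fin n → ℝ) →ₗ[ℝ] (Fin n → ℝ) := ∑ w : U, ψ w k • X ⟨sigmaMap e κ w, 0⟩ with hM
  have hMQ : ∀ v, M v = T (Q k (T.symm v)) := fun v => by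
    simp only [hM, hQdef, LinearMap.sum_apply, LinearMap.smul_apply, map_sum, map_smul]
    refine Finset.sum_congr rfl fun w _ => ?_
    rw [← hT, LinearEquiv.apply_symm_apply]
    rfl
  have hsymm : Z.repr (T.symm (Z j)) k = Z.repr (T (Z k)) j := by
    rw [hZ.repr_eq, hZ.repr_eq, ← hTB, LinearEquiv.apply_symm_apply, hB.symm]
  have h1 : LinearMap.trace ℝ _ (M * Q j) = n * (n * (Z.repr (T (Z k)) j) ^ 2) := by
    rw [trace_mul_of_apply_eq (hψ j), hMQ, hψ k, hsymm, map_smul, map_smul, Finsupp.smul_apply,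
      smul_eq_mul]
    ring
  have h2 : LinearMap.trace ℝ _ (M * Q j) = n := by
    have hterm : ∀ w u : U, LinearMap.trace ℝ _
        ((ψ w k • X (⟨sigmaMap e κ w, 0⟩ : HGroup f)) * (ψ u j • X ⟨(u : V), 0⟩))
        = if w = 0 ∧ u = 0 then (n : ℝ) else 0 := by
      intro w u
      rw [smul_mul_smul_comm, map_smul, ← map_mul, mul_def]
      split_ifs with h0
      · obtain ⟨rfl, rfl⟩ := h0
        simp only [ZeroMemClass.coe_zero, map_zero, add_zero, hψ0]
        rw [hX]
        simp
      · have hne : sigmaMap e κ w + u ≠ 0 := fun hsum => by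
          have h3 : sigmaMap e κ w = u := by
            rw [eq_neg_of_add_eq_zero_left hsum]
            exact neg_eq_of_add_eq_zero_left (vec_add_self K (u : V))
          have h4 : (w : V) = 0 :=
            eq_zero_of_sigmaMap_mem he hU.isotropic hκ w.2 (h3 ▸ u.2)
          rw [h4, map_zero] at h3
          exact h0 ⟨Subtype.ext h4, Subtype.ext h3.symm⟩
        rw [hX.trace_eq_zero hf hω hne, smul_zero]
    simp only [hM, hQdef, Finset.sum_mul_sum, map_sum, hterm]
    rw [Finset.sum_eq_single (0 : U), Finset.sum_eq_single (0 : U)]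
    · simp
    · intro u _ hu
      simp [hu]
    · simp
    · intro w _ hw
      simp [hw]
    · simp
  rw [h1] at h2
  exact mul_left_cancel₀ hn0 (h2.trans (mul_one _).symm)

end Entries

/-! ### Signs of the traces of the powers -/

/-- If `A ^ (q + 1) = 1` with `q` even and in dimension `q ^ 2` all powers `A ^ i`, `1 ≤ i ≤ q`,
have trace `± q`, then all these signs are negative and `A` has no fixed vectors: the dimension `d` of
the fixed space satisfies `(q + 1) d = 2 q m`, where `m ≤ q` is the number of positive signs. -/
theorem trace_pow_eq_neg_of_sq {E : Type*} [AddCommGroup E] [Module ℝ E] [FiniteDimensional ℝ E]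
    {A : E →ₗ[ℝ] E} {q : ℕ} (hq0 : 0 < q) (heven : Even q) (hA : A ^ (q + 1) = 1)
    (hdim : Module.finrank ℝ E = q ^ 2)
    (htr : ∀ i, 1 ≤ i → i ≤ q → (LinearMap.trace ℝ E (A ^ i)) ^ 2 = (q : ℝ) ^ 2) :
    (∀ i, 1 ≤ i → i ≤ q → LinearMap.trace ℝ E (A ^ i) = -q) ∧ ∀ v, A v = v → v = 0 := by
  classical
  let S : Finset ℕ := {i ∈ Finset.range q | LinearMap.trace ℝ E (A ^ (i + 1)) = q}
  have hqr : (0 : ℝ) < q := by exact_mod_cast hq0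
  have hval : ∀ i ∈ Finset.range q, LinearMap.trace ℝ E (A ^ (i + 1))
      = 2 * q * (if LinearMap.trace ℝ E (A ^ (i + 1)) = q then 1 else 0) - q := by
    intro i hi
    rcases sq_eq_sq_iff_eq_or_eq_neg.1 (htr (i + 1) (by omega) (Finset.mem_range.1 hi)) with h | h
    · rw [if_pos h, h]
      ring
    · rw [if_neg (by rw [h]; linarith), h]
      ring
  let P : E →ₗ[ℝ] E := ((q + 1 : ℕ) : ℝ)⁻¹ • ∑ i ∈ Finset.range (q + 1), A ^ i
  have hq1 : ((q + 1 : ℕ) : ℝ) ≠ 0 := by positivity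
  have hP : LinearMap.IsProj (LinearMap.ker (A - 1)) P := by
    refine ⟨fun v => ?_, fun v hv => ?_⟩
    · rw [LinearMap.mem_ker, ← Module.End.mul_apply, mul_smul_comm, mul_geom_sum, hA, sub_self,
        smul_zero, LinearMap.zero_apply]
    · have hv1 : A v = v := sub_eq_zero.1 hv
      have hvi : ∀ i : ℕ, (A ^ i) v = v := fun i => by
        induction i with
        | zero => rfl
        | succ i ih => rw [pow_succ', Module.End.mul_apply, ih, hv1]
      simp only [P, LinearMap.smul_apply, LinearMap.sum_apply, hvi, Finset.sum_const,
        Finset.card_range]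
      rw [← Nat.cast_smul_eq_nsmul ℝ, smul_smul, inv_mul_cancel₀ hq1, one_smul]
  have h1 := hP.trace
  set d := Module.finrank ℝ (LinearMap.ker (A - 1)) with hd
  have h2 : ((q + 1 : ℕ) : ℝ) * d = 2 * q * S.card := by
    rw [← h1]
    simp only [P, map_smul, smul_eq_mul, map_sum]
    rw [mul_inv_cancel_left₀ hq1, Finset.sum_range_succ', Finset.sum_congr rfl hval, pow_zero,
      LinearMap.trace_one, hdim, Finset.sum_sub_distrib, ← Finset.mul_sum, Finset.sum_boole]
    simp only [Finset.sum_const, Finset.card_range, nsmul_eq_mul, S]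
    push_cast
    ring
  have h3 : (q + 1) * d = 2 * q * S.card := by exact_mod_cast h2
  have hcop : Nat.Coprime (q + 1) (2 * q) := by
    refine Nat.Coprime.mul_right ?_ (by simp)
    rw [Nat.coprime_two_right]
    exact heven.add_one
  have hdvd : q + 1 ∣ S.card := hcop.dvd_of_dvd_mul_left ⟨d, h3.symm⟩
  have hle : S.card ≤ q := (Finset.card_filter_le _ _).trans (Finset.card_range q).le
  have hS : S.card = 0 := Nat.eq_zero_of_dvd_of_lt hdvd (by omega)
  have hd0 : d = 0 := by
    rw [hS, mul_zero] at h3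
    exact (mul_eq_zero.1 h3).resolve_left (by omega)
  constructor
  · intro i hi hiq
    refine (sq_eq_sq_iff_eq_or_eq_neg.1 (htr i hi hiq)).resolve_left fun h => ?_
    obtain ⟨k, rfl⟩ := Nat.exists_eq_add_of_le' hi
    have hk : k ∈ S := Finset.mem_filter.2 ⟨Finset.mem_range.2 (by omega), h⟩
    rw [Finset.card_eq_zero.1 hS] at hk
    exact Finset.notMem_empty _ hk
  · intro v hv
    have h4 : LinearMap.ker (A - 1) = ⊥ := Submodule.finrank_eq_zero.1 hd0
    have h5 : v ∈ LinearMap.ker (A - 1) := sub_eq_zero.2 hv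
    rwa [h4] at h5

/-! ### Arithmetic of the generator, and Hadamard matrices -/

section Arithmetic

/-- `μ ^ (q - 1)` has order `q + 1` for a generator `μ` of the multiplicative group of the field
with `q ^ 2` elements. -/
theorem orderOf_generator_pow {K : Type*} [Field K] {q : ℕ} (hq : 2 ≤ q)
    (hK : Nat.card K = q ^ 2) {μ : Kˣ} (hμ : ∀ x : Kˣ, x ∈ Subgroup.zpowers μ) :
    orderOf ((μ : K) ^ (q - 1)) = q + 1 := by
  have : Finite K := Nat.finite_of_card_ne_zero (by rw [hK]; positivity)
  have h1 : orderOf μ = (q - 1) * (q + 1) := by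
    rw [orderOf_eq_card_of_forall_mem_zpowers hμ, Nat.card_units, hK]
    obtain ⟨k, rfl⟩ := Nat.exists_eq_add_of_le' hq
    simp only [show k + 2 - 1 = k + 1 by omega]
    rw [Nat.sub_eq_iff_eq_add (by nlinarith)]
    ring
  rw [← Units.val_pow_eq_pow_val, orderOf_units, orderOf_pow_of_dvd (by omega) (by simp [h1]), h1,
    Nat.mul_div_cancel_left _ (by omega)]

end Arithmetic

/-- A square matrix of order `q ^ 2` whose columns are the coordinates of an orthonormal basis and
all of whose entries have absolute value `1 / q` is, up to the factor `q`, a Hadamard matrix. -/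
theorem Matrix.isHadamard_smul_of_sq_eq {q : ℕ} {M : Matrix (Fin (q ^ 2)) (Fin (q ^ 2)) ℝ}
    (hM : M.transpose * M = 1) (hsq : ∀ j k, ((q ^ 2 : ℕ) : ℝ) * M j k ^ 2 = 1) :
    Matrix.IsHadamard ((q : ℝ) • M) := by
  have hM' : M * M.transpose = 1 := mul_eq_one_comm.1 hM
  refine ⟨fun j k => ?_, ?_, ?_⟩
  · have h : ((q : ℝ) * M j k) * ((q : ℝ) * M j k) = 1 := by
      have := hsq j k
      push_cast at this
      linear_combination this
    rw [Unitary.mem_iff]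
    exact ⟨by simpa using h, by simpa using h⟩
  · simp [Matrix.conjTranspose_eq_transpose_of_trivial, hM', smul_smul, pow_two]
  · simp [Matrix.conjTranspose_eq_transpose_of_trivial, hM, smul_smul, pow_two]

theorem mainTheorem2 (r q : ℕ) (hr : 1 ≤ r) (hq : q = 2 ^ r)
    {K V : Type*} [Field K] [CharP K 2] [AddCommGroup V] [Module K V]
    (hK : Nat.card K = q ^ 2) (hV : Module.finrank K V = 2)
    (f : SesqForm r K V) (hf : IsNondegHermitian f)
    (e : Module.Basis (Fin 2) K V) (he : ∀ i j, f (e i) (e j) = if i = j then 1 else 0)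
    (μ : Kˣ) (hμ : ∀ x : Kˣ, x ∈ Subgroup.zpowers μ)
    (Y : Representation ℂ (HGroup f) (Fin (q ^ 2) → ℂ)) (hY : Y.IsIrreducible) :
    (∃ X : Representation ℝ (HGroup f) (Fin (q ^ 2) → ℝ), Affords X Y) ∧
    ∀ X : Representation ℝ (HGroup f) (Fin (q ^ 2) → ℝ), Affords X Y →
      (∃ B, IsInvariantForm X B) ∧
      ∀ B, IsInvariantForm X B →
        (∃ D, IsNormalizer X B (hatMap (sigmaMap e ((μ : K) ^ (q - 1)))) (q + 1) D) ∧
        ∀ D, IsNormalizer X B (hatMap (sigmaMap e ((μ : K) ^ (q - 1)))) (q + 1) D →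
          (∀ v, D v = v → v = 0) ∧
          ∀ U : Submodule K V, IsIsotropicLine f U →
            (∃ Z, IsEigenbasis X B U Z) ∧
            ∀ Z, IsEigenbasis X B U Z → ∀ i : ℕ, 1 ≤ i → i ≤ q →
              (∀ j, powMatrix Z D i j j = -1 / (q : ℝ)) ∧
              Matrix.IsHadamard ((q : ℝ) • powMatrix Z D i) ∧
              ∀ j, ((q : ℝ) • powMatrix Z D i) j j = -1 := by
  have heven : Even q := by
    rw [hq]
    exact (even_two).pow_of_ne_zero (by omega)
  have hq2 : 2 ≤ q := by
    rw [hq]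
    exact Nat.le_self_pow (by omega) 2
  have hq0 : (q : ℝ) ≠ 0 := by positivity
  have hfin : Finite K := Nat.finite_of_card_ne_zero (by rw [hK]; positivity)
  have : FiniteDimensional K V := Module.finite_of_finrank_eq_succ hV
  have : Finite V := Module.finite_of_finite K
  have : Finite (HGroup f) := Finite.of_injective (fun x : HGroup f => (x.vec, x.scal))
    fun x y h => HGroup.ext (congrArg Prod.fst h) (congrArg Prod.snd h)
  -- `D ^ i` belongs to `λ ^ i`, and `λ = μ ^ (q - 1)` has order `q + 1`.
  have hord := orderOf_generator_pow hq2 hK hμ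
  set a : K := (μ : K) ^ (q - 1) with ha
  obtain ⟨ω, hYω, hω⟩ := exists_centralCharacter (by nlinarith) hY hf
  constructor
  · -- In characteristic two, `α u₁ + β u₂ = α (u₁ + u₂) + (α + β) u₂`.
    have hp : f (e 0 + e 1) (e 0 + e 1) = 0 :=
      (isIsotropicLine_span_add (f := f) he).isotropic _ (Submodule.mem_span_singleton_self _) _
        (Submodule.mem_span_singleton_self _)
    obtain ⟨X, hX⟩ := exists_real_representation (f := f) (Finite.equivFinOfCardEq hK).symm
      (p := e 0 + e 1) (w := e 1) hp (e.coord 0) (e.coord 0 + e.coord 1) (fun v => by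
        obtain ⟨α, β, rfl⟩ := e.exists_eq_smul_add_smul v
        simp only [map_add, map_smul, Module.Basis.coord_apply, Module.Basis.repr_self,
          LinearMap.add_apply, smul_eq_mul, Finsupp.single_eq_same, ne_eq, zero_ne_one, one_ne_zero,
          not_false_eq_true, Finsupp.single_eq_of_ne, mul_one, mul_zero, add_zero, zero_add,
          smul_add, add_smul]
        have := vec_add_self K (α • e 1)
        rw [add_assoc, ← add_assoc (α • e 1), this, zero_add]) ω
    exact ⟨X, hX.affords hYω hf hω⟩
  intro X hXY
  have hX := hXY.hasCentralCharacter hYω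
  refine ⟨exists_isInvariantForm X, fun B hB => ⟨?_, fun D hD => ?_⟩⟩
  · exact hX.exists_isNormalizer hf hω hV hK he hB hq heven (hord ▸ pow_orderOf_eq_one a)
  have hD1 : ∀ x v, X (hatMap (sigmaMap e a) x) (D v) = D (X x v) := fun x v => by
    rw [hD.conj, LinearEquiv.symm_apply_apply]
  have hDi := apply_hatMap_pow hD1
  have hDB := isometry_pow hD.isometry
  have hai : ∀ i, 1 ≤ i → i ≤ q → a ^ i ≠ 1 := fun i hi hiq =>
    pow_ne_one_of_lt_orderOf (by omega) (by omega)
  have hcoe : ∀ i : ℕ, ((D ^ i : (Fin (q ^ 2) → ℝ) ≃ₗ[ℝ] (Fin (q ^ 2) → ℝ)) :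
      (Fin (q ^ 2) → ℝ) →ₗ[ℝ] (Fin (q ^ 2) → ℝ))
      = (D : (Fin (q ^ 2) → ℝ) →ₗ[ℝ] (Fin (q ^ 2) → ℝ)) ^ i := fun i => by
    refine LinearMap.ext fun v => ?_
    rw [LinearEquiv.coe_coe, LinearEquiv.pow_apply, Module.End.pow_apply]
    rfl
  -- The diagonal and the size of the entries, in one eigenbasis, give the traces up to sign.
  have htr : ∀ i, 1 ≤ i → i ≤ q → (LinearMap.trace ℝ _
      ((D : (Fin (q ^ 2) → ℝ) →ₗ[ℝ] (Fin (q ^ 2) → ℝ)) ^ i)) ^ 2 = (q : ℝ) ^ 2 := by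
    intro i hi hiq
    have hU := isIsotropicLine_span_add (f := f) he
    obtain ⟨Z, hZ⟩ := hX.exists_isEigenbasis hf hω hV hK hU hB
    let j : Fin (q ^ 2) := ⟨0, by positivity⟩
    have h1 := hX.mul_diag_eq_trace hf hω hK he hU hZ (hDi i) j
    have h2 := hX.mul_sq_entry_eq_one hf hω hK he hU hB hZ (hai i hi hiq) (hDi i) (hDB i) j j
    rw [hcoe] at h1
    rw [← h1, mul_pow, pow_two ((q ^ 2 : ℕ) : ℝ), mul_assoc, h2]
    push_cast
    ring
  obtain ⟨hneg, hfixed⟩ := trace_pow_eq_neg_of_sq (by omega) heven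
    (by rw [← hcoe, hD.pow_eq_one]; rfl) (Module.finrank_fin_fun ℝ) htr
  refine ⟨hfixed, fun U hU => ⟨hX.exists_isEigenbasis hf hω hV hK hU hB,
    fun Z hZ i hi hiq => ?_⟩⟩
  have hentry : ∀ j k, powMatrix Z D i j k = Z.repr ((D ^ i) (Z k)) j := fun j k => by
    rw [powMatrix, LinearMap.toMatrix_apply]
    rfl
  have hdiag : ∀ j, (q : ℝ) * powMatrix Z D i j j = -1 := fun j => by
    have h1 := hX.mul_diag_eq_trace hf hω hK he hU hZ (hDi i) j
    rw [hcoe, hneg i hi hiq, ← hentry] at h1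
    push_cast at h1
    exact mul_left_cancel₀ hq0 (by linear_combination h1)
  refine ⟨fun j => ?_, ?_, hdiag⟩
  · rw [eq_div_iff hq0, mul_comm, hdiag]
  · refine Matrix.isHadamard_smul_of_sq_eq ?_ fun j k => ?_
    · ext j k
      rw [Matrix.mul_apply, Matrix.one_apply, ← hZ.orthonormal j k, ← hDB i, hZ.form_eq_sum]
      exact Finset.sum_congr rfl fun l _ => by rw [Matrix.transpose_apply, hentry, hentry]
    · rw [hentry]
      exact hX.mul_sq_entry_eq_one hf hω hK he hU hB hZ (hai i hi hiq) (hDi i) (hDB i) j k
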